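/- Let $0<\kappa<1$ and $\lambda=(1-\kappa^2)^{1/2}$. Let $F={}_2F_1$ be the Gauss hypergeometric function. The rule $f(T)=\int_0^T F(\tfrac14,\tfrac34;\tfrac12;\kappa^2\sin^2 t)\,dt$ defines a strictly increasing bijection $f:\mathbb R\to\mathbb R$; let $\phi:\mathbb R\to\mathbb R$ be its inverse, let $\psi=\arcsin(\kappa\sin\phi)$, and let $d_\kappa=\cos\psi:\mathbb R\to\mathbb R$. There is a lattice $\Lambda\subset\mathbb C$ whose invariants are $g_2=\lambda^2+\tfrac13$ and $g_3=\tfrac13\lambda^2-\tfrac1{27}$. For any such $\Lambda$, let $p_\kappa=\wp(\,\cdot\,;g_2,g_3)$ be its Weierstrass function. Then $$(1-d_\kappa(u))\left(\tfrac13+p_\kappa(u)\right)=\tfrac12\kappa^2\qquad\text{for all } u\in\mathbb R\setminus\Lambda .$$ Hence $d_\kappa$ extends to an elliptic function, namely $$\mathrm{dn}_2=1-\frac{\tfrac12\kappa^2}{\tfrac13+p_\kappa}$$ (with value $1$ at the points of $\Lambda$, which are the poles of $p_\kappa$): the function $\mathrm{dn}_2$ is meromorphic on $\mathbb C$ and $\Lambda$-periodic,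 it is holomorphic at every real point, and $\mathrm{dn}_2(u)=d_\kappa(u)$ for every $u\in\mathbb R$. -/

import Mathlib

namespace Shen

/-- The complementary modulus `λ = (1 - κ²)^{1/2}`. -/
noncomputable def compl (κ : ℝ) : ℝ := Real.sqrt (1 - κ ^ 2)

/-- The integrand `F(1/4, 3/4; 1/2; κ² sin² t)`, with `F` the Gauss hypergeometric function. -/
noncomputable def integrand (κ t : ℝ) : ℝ :=
  ₂F₁ (1 / 4 : ℝ) (3 / 4 : ℝ) (1 / 2 : ℝ) (κ ^ 2 * Real.sin t ^ 2)

/-- The incomplete integral `f(T) = ∫₀ᵀ F(1/4, 3/4; 1/2; κ² sin² t) dt`. -/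
noncomputable def incomplete (κ T : ℝ) : ℝ := ∫ t in (0 : ℝ)..T, integrand κ t

/-- The inverse `φ : ℝ → ℝ` of `f`. That `f` is a strictly increasing bijection for `0 < κ < 1`,
so that this is its two-sided inverse, is proved in `strictMono_incomplete`,
`bijective_incomplete` and `incomplete_amplitude` below. -/
noncomputable def amplitude (κ : ℝ) : ℝ → ℝ := Function.invFun (incomplete κ)

/-- The subsidiary angular function `ψ = arcsin (κ sin φ)`. -/
noncomputable def angle (κ u : ℝ) : ℝ := Real.arcsin (κ * Real.sin (amplitude κ u))

/-- The function `d_κ = cos ψ : ℝ → ℝ`. -/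
noncomputable def d (κ u : ℝ) : ℝ := Real.cos (angle κ u)

/-- The invariants of the lattice `L` are `g₂ = λ² + 1/3` and `g₃ = λ²/3 - 1/27`; in this case
`℘[L]` is the Weierstrass function `p_κ = ℘(•; g₂, g₃)`. -/
def HasInvariants (κ : ℝ) (L : PeriodPair) : Prop :=
  L.g₂ = (compl κ : ℂ) ^ 2 + 1 / 3 ∧ L.g₃ = (compl κ : ℂ) ^ 2 / 3 - 1 / 27

open scoped Classical in
/-- The function `dn₂ = 1 - (κ²/2) / (1/3 + ℘)` for the lattice `L`. At the lattice points, the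
poles of `℘`, the singularity is removable and the value is `1`.
The poles of `dn₂` are the points where `℘ = -1/3`; the value given there is immaterial. -/
noncomputable def dn₂ (κ : ℝ) (L : PeriodPair) (z : ℂ) : ℂ :=
  if z ∈ L.lattice then 1 else 1 - ((κ : ℂ) ^ 2 / 2) / (1 / 3 + L.weierstrassP z)

/-- `f` is an elliptic function with respect to the lattice `L`. -/
def IsElliptic (L : PeriodPair) (f : ℂ → ℂ) : Prop :=
  Meromorphic f ∧ ∀ l ∈ L.lattice, ∀ z : ℂ, f (z + l) = f z

/-! The integral `f` is a strictly increasing bijection. -/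

theorem radius_eq_one :
    (ordinaryHypergeometricSeries ℝ (1 / 4 : ℝ) (3 / 4 : ℝ) (1 / 2 : ℝ)).radius = 1 := by
  refine ordinaryHypergeometricSeries_radius_eq_one ℝ _ _ _ fun k => ?_
  have hk : (0 : ℝ) ≤ k := Nat.cast_nonneg k
  refine ⟨?_, ?_, ?_⟩ <;> intro h <;> linarith

theorem arg_mem_ball {κ : ℝ} (h0 : 0 < κ) (h1 : κ < 1) (t : ℝ) :
    κ ^ 2 * Real.sin t ^ 2 ∈ Metric.eball (0 : ℝ) 1 := by
  have h : κ ^ 2 * Real.sin t ^ 2 < 1 := by nlinarith [Real.sin_sq_le_one t, sq_nonneg κ]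
  have h' : 0 ≤ κ ^ 2 * Real.sin t ^ 2 := by positivity
  rw [Metric.mem_eball, edist_dist, Real.dist_eq, sub_zero, abs_of_nonneg h']
  simpa using (ENNReal.ofReal_lt_one).2 h

theorem continuous_integrand {κ : ℝ} (h0 : 0 < κ) (h1 : κ < 1) : Continuous (integrand κ) := by
  have hf := (ordinaryHypergeometricSeries ℝ (1 / 4 : ℝ) (3 / 4 : ℝ)
    (1 / 2 : ℝ)).hasFPowerSeriesOnBall (by rw [radius_eq_one]; exact one_pos)
  rw [radius_eq_one] at hf
  exact hf.continuousOn.comp_continuous (by fun_prop) (arg_mem_ball h0 h1)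

theorem one_le_integrand {κ : ℝ} (h0 : 0 < κ) (h1 : κ < 1) (t : ℝ) : 1 ≤ integrand κ t := by
  have hs : HasSum (fun n => ordinaryHypergeometricSeries ℝ (1 / 4 : ℝ) (3 / 4 : ℝ) (1 / 2 : ℝ) n
      fun _ => κ ^ 2 * Real.sin t ^ 2) (integrand κ t) :=
    (ordinaryHypergeometricSeries ℝ (1 / 4 : ℝ) (3 / 4 : ℝ) (1 / 2 : ℝ)).hasSum
      (by rw [radius_eq_one]; exact arg_mem_ball h0 h1 t)
  have key := hs.summable.le_tsum 0 (fun n _ => by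
    rw [ordinaryHypergeometricSeries_apply_eq, smul_eq_mul]
    have a := (ascPochhammer_pos n (1 / 4 : ℝ) (by norm_num)).le
    have b := (ascPochhammer_pos n (3 / 4 : ℝ) (by norm_num)).le
    have c := (ascPochhammer_pos n (1 / 2 : ℝ) (by norm_num)).le
    positivity)
  rw [hs.tsum_eq] at key
  rw [ordinaryHypergeometricSeries_apply_eq] at key
  simpa using key

theorem hasDerivAt_incomplete {κ : ℝ} (h0 : 0 < κ) (h1 : κ < 1) (T : ℝ) :
    HasDerivAt (incomplete κ) (integrand κ T) T :=
  (continuous_integrand h0 h1).integral_hasStrictDerivAt 0 T |>.hasDerivAt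

theorem strictMono_incomplete {κ : ℝ} (h0 : 0 < κ) (h1 : κ < 1) : StrictMono (incomplete κ) :=
  strictMono_of_deriv_pos fun T => by
    rw [(hasDerivAt_incomplete h0 h1 T).deriv]
    exact one_pos.trans_le (one_le_integrand h0 h1 T)

theorem bijective_incomplete {κ : ℝ} (h0 : 0 < κ) (h1 : κ < 1) :
    Function.Bijective (incomplete κ) := by
  refine ⟨(strictMono_incomplete h0 h1).injective, ?_⟩
  have hm : Monotone fun T => incomplete κ T - T := by
    have hd := fun T => (hasDerivAt_incomplete h0 h1 T).sub (hasDerivAt_id T)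
    refine monotone_of_deriv_nonneg (fun T => (hd T).differentiableAt) fun T => ?_
    have h := (hd T).deriv
    have h' := one_le_integrand h0 h1 T
    change deriv (incomplete κ - id) T ≥ 0
    rw [h]; linarith
  have hz : incomplete κ 0 = 0 := by simp [incomplete]
  have hc : Continuous (incomplete κ) :=
    continuous_iff_continuousAt.2 fun T => (hasDerivAt_incomplete h0 h1 T).continuousAt
  refine hc.surjective ?_ ?_
  · refine Filter.tendsto_atTop_mono' _ ?_ Filter.tendsto_id
    filter_upwards [Filter.eventually_ge_atTop 0] with T hT
    have := hm hT
    simp only [hz, id] at this ⊢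
    linarith
  · refine Filter.tendsto_atBot_mono' _ ?_ Filter.tendsto_id
    filter_upwards [Filter.eventually_le_atBot 0] with T hT
    have := hm hT
    simp only [hz, id] at this ⊢
    linarith

theorem incomplete_amplitude {κ : ℝ} (h0 : 0 < κ) (h1 : κ < 1) (u : ℝ) :
    incomplete κ (amplitude κ u) = u :=
  Function.rightInverse_invFun (bijective_incomplete h0 h1).surjective u

end Shen

/-! ### Closed form of the hypergeometric integrand -/

namespace Shen

open Real

/-! Both `d` and `dn₂` solve `x'' = 2x(1 - x) - (x² - λ²)` with `x(0) = 1` and `x'(0) = 0`. For `d`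
this rests on `F(1/4, 3/4; 1/2; sin² x) = cos (x/2) / cos x`, which makes the derivatives of `φ` and
`ψ` elementary. For `dn₂`, put `q = 1/3 + ℘`: the given invariants mean `q'² = 4q³ - 4q² + κ²q`, and
the equation for `1 - κ²/(2q)` follows. The first-order equation `x'² = 2(1 - x)(x² - λ²)` would not
suffice, since the constant `1` solves it with the same initial value.

Local uniqueness is spread along `ℝ` by connectedness (`eventuallyEq_dn₂_d_all`). No pole of `dn₂`
intervenes: as long as the two functions agree, `(1 - d) q = κ²/2`, and this passes to limits, where
it forbids `q = 0`.

A lattice exists because `g₂³ - 27g₃² = λ²κ⁴ > 0`: on the imaginary axis `E₆²/E₄³` takes all values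
in `[0, 1)`, and scaling the lattice adjusts `g₂` and the sign of `g₃`. -/

theorem hasSum_rpow_neg_half {x : ℝ} (hx : |x| < 1) :
    HasSum (fun n : ℕ => (ascPochhammer ℝ n).eval (1 / 2) / n.factorial * x ^ n)
      ((1 - x) ^ (-(1 / 2) : ℝ)) := by
  have h := (Real.one_div_one_sub_rpow_hasFPowerSeriesOnBall_zero (1 / 2)).hasSum (y := x)
    (by simpa [enorm_eq_nnnorm, Metric.mem_eball, edist_dist] using hx)
  have hx1 : 0 ≤ 1 - x := by linarith [le_abs_self x]
  simp only [zero_add, one_div, ← Real.rpow_neg hx1] at h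
  simp only [one_div]
  refine h.congr_fun fun n => ?_
  have hc : (n.factorial : ℝ) * Ring.choose ((2 : ℝ)⁻¹ + n - 1) n
      = (ascPochhammer ℝ n).eval (2 : ℝ)⁻¹ := by
    have := Ring.factorial_nsmul_multichoose_eq_ascPochhammer (2 : ℝ)⁻¹ n
    rw [nsmul_eq_mul, Polynomial.ascPochhammer_smeval_eq_eval] at this
    rw [← this, Ring.choose]
    congr 2
    ring
  have hn : (n.factorial : ℝ) ≠ 0 := by positivity
  simp only [FormalMultilinearSeries.ofScalars_apply_eq, smul_eq_mul]
  rw [← hc]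
  field_simp

/-- Separating even and odd factors gives `(1/2)_{2n} = 4ⁿ (1/4)_n (3/4)_n` and `(2n)! = 4ⁿ n!
(1/2)_n`; the powers of `4` cancel. -/
theorem ascPochhammer_half_two_mul (n : ℕ) :
    ((ascPochhammer ℝ (2 * n)).eval (1 / 2) : ℝ) / (2 * n).factorial =
      (n.factorial : ℝ)⁻¹ * (ascPochhammer ℝ n).eval (1 / 4) * (ascPochhammer ℝ n).eval (3 / 4) *
        ((ascPochhammer ℝ n).eval (1 / 2))⁻¹ := by
  induction n with
  | zero => simp
  | succ n ih =>
    have h1 := (ascPochhammer_pos n (1 / 2 : ℝ) (by norm_num)).ne'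
    have h2 : (n.factorial : ℝ) ≠ 0 := by positivity
    have h3 : ((2 * n).factorial : ℝ) ≠ 0 := by positivity
    have h4 : (n : ℝ) + 1 ≠ 0 := by positivity
    have h5 : (1 / 2 : ℝ) + n ≠ 0 := by positivity
    have h6 : 2 * (n : ℝ) + 1 ≠ 0 := by positivity
    have h7 : 2 * (n : ℝ) + 1 + 1 ≠ 0 := by positivity
    rw [show 2 * (n + 1) = 2 * n + 1 + 1 by ring]
    simp only [ascPochhammer_succ_eval, Nat.factorial_succ, Nat.cast_mul, Nat.cast_add,
      Nat.cast_one, Nat.cast_ofNat]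
    rw [div_eq_iff h3] at ih
    rw [ih]
    field_simp
    ring

/-- `F(1/4, 3/4; 1/2; z²)` is the even part of `(1 - z)^(-1/2)`. -/
theorem ordinaryHypergeometric_sq {z : ℝ} (hz : |z| < 1) :
    ₂F₁ (1 / 4 : ℝ) (3 / 4 : ℝ) (1 / 2 : ℝ) (z ^ 2) =
      ((1 - z) ^ (-(1 / 2) : ℝ) + (1 + z) ^ (-(1 / 2) : ℝ)) / 2 := by
  have h1 := hasSum_rpow_neg_half hz
  have h2 := hasSum_rpow_neg_half (x := -z) (by rwa [abs_neg])
  have h := (h1.add h2).div_const 2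
  rw [sub_neg_eq_add] at h
  have hinj : Function.Injective fun n : ℕ => 2 * n := fun a b hab => by simpa using hab
  have h' := (hinj.hasSum_iff (fun m hm => ?_)).2 h
  · rw [ordinaryHypergeometric_eq_tsum, ← h'.tsum_eq]
    refine tsum_congr fun n => ?_
    simp only [Function.comp, smul_eq_mul]
    rw [← ascPochhammer_half_two_mul, (even_two_mul n).neg_pow, ← pow_mul]
    ring
  · have hm' : Odd m := by
      rw [← Nat.not_even_iff_odd, even_iff_exists_two_mul]
      rintro ⟨c, rfl⟩
      exact hm ⟨c, rfl⟩
    rw [hm'.neg_pow]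
    ring

/-- With `c = cos (x/2)` and `s = sin (x/2)`, `1 ∓ sin x = (c ∓ s)²`, so the two inverse square
roots are rational in `c` and `s`. -/
theorem ordinaryHypergeometric_sin_sq {x : ℝ} (h1 : -(π / 2) < x) (h2 : x < π / 2) :
    ₂F₁ (1 / 4 : ℝ) (3 / 4 : ℝ) (1 / 2 : ℝ) (sin x ^ 2) = cos (x / 2) / cos x := by
  have hc : 0 < cos x := cos_pos_of_mem_Ioo ⟨h1, h2⟩
  have hc2 : 0 < cos (x / 2) := cos_pos_of_mem_Ioo ⟨by linarith, by linarith⟩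
  have hs := sin_sq_add_cos_sq x
  have hs2 := sin_sq_add_cos_sq (x / 2)
  have hx : x = 2 * (x / 2) := by ring
  have hsin : sin x = 2 * sin (x / 2) * cos (x / 2) := by
    conv_lhs => rw [hx, sin_two_mul]
  have hcos : cos x = cos (x / 2) ^ 2 - sin (x / 2) ^ 2 := by
    conv_lhs => rw [hx, cos_two_mul']
  set c := cos (x / 2)
  set s := sin (x / 2)
  -- `c² - s² = cos x > 0`, so `c - s` and `c + s` are positive and are the correct square roots.
  have habs : |s| < c := abs_lt_of_sq_lt_sq (by nlinarith) hc2.le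
  obtain ⟨ha, hb⟩ := abs_lt.1 habs
  rw [ordinaryHypergeometric_sq (abs_lt.2 ⟨by nlinarith, by nlinarith⟩)]
  have e1 : 1 - sin x = (c - s) ^ 2 := by rw [hsin]; linear_combination -hs2
  have e2 : 1 + sin x = (c + s) ^ 2 := by rw [hsin]; linear_combination -hs2
  have hr (y : ℝ) (hy : 0 < y) : (y ^ 2) ^ (-(1 / 2) : ℝ) = y⁻¹ := by
    rw [rpow_neg (by positivity), ← sqrt_eq_rpow, sqrt_sq hy.le]
  rw [e1, e2, hr _ (by linarith), hr _ (by linarith), hcos]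
  have h3 : c - s ≠ 0 := by linarith
  have h4 : c + s ≠ 0 := by linarith
  rw [show c ^ 2 - s ^ 2 = (c - s) * (c + s) by ring]
  field_simp
  ring

/-! ### The differential equation of `d` -/

section Amplitude

variable {κ : ℝ} (h0 : 0 < κ) (h1 : κ < 1)
include h0 h1

theorem abs_mul_sin_lt_one (t : ℝ) : |κ * sin t| < 1 := by
  rw [abs_mul, abs_of_pos h0]
  nlinarith [abs_sin_le_one t, abs_nonneg (sin t)]

theorem sin_angle (u : ℝ) : sin (angle κ u) = κ * sin (amplitude κ u) := by
  have h := abs_lt.1 (abs_mul_sin_lt_one h0 h1 (amplitude κ u))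
  exact sin_arcsin h.1.le h.2.le

theorem angle_mem (u : ℝ) : angle κ u ∈ Set.Ioo (-(π / 2)) (π / 2) := by
  have h := abs_lt.1 (abs_mul_sin_lt_one h0 h1 (amplitude κ u))
  exact ⟨neg_pi_div_two_lt_arcsin.2 h.1, arcsin_lt_pi_div_two.2 h.2⟩

theorem cos_angle_pos (u : ℝ) : 0 < cos (angle κ u) := cos_pos_of_mem_Ioo (angle_mem h0 h1 u)

theorem cos_half_angle_pos (u : ℝ) : 0 < cos (angle κ u / 2) := by
  have h := angle_mem h0 h1 u
  exact cos_pos_of_mem_Ioo ⟨by linarith [h.1, pi_pos], by linarith [h.2, pi_pos]⟩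

theorem integrand_amplitude (u : ℝ) :
    integrand κ (amplitude κ u) = cos (angle κ u / 2) / cos (angle κ u) := by
  rw [integrand, ← mul_pow, ← sin_angle h0 h1]
  exact ordinaryHypergeometric_sin_sq (angle_mem h0 h1 u).1 (angle_mem h0 h1 u).2

theorem amplitude_incomplete (T : ℝ) : amplitude κ (incomplete κ T) = T :=
  Function.leftInverse_invFun (bijective_incomplete h0 h1).injective T

theorem continuous_amplitude : Continuous (amplitude κ) := by
  refine Monotone.continuous_of_surjective (fun a b hab => ?_)
    fun T => ⟨_, amplitude_incomplete h0 h1 T⟩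
  rw [← (strictMono_incomplete h0 h1).le_iff_le, incomplete_amplitude h0 h1,
    incomplete_amplitude h0 h1]
  exact hab

theorem hasDerivAt_amplitude (u : ℝ) :
    HasDerivAt (amplitude κ) (cos (angle κ u) / cos (angle κ u / 2)) u := by
  have h := HasDerivAt.of_local_left_inverse (continuous_amplitude h0 h1).continuousAt
    (hasDerivAt_incomplete h0 h1 (amplitude κ u))
    (one_pos.trans_le (one_le_integrand h0 h1 _)).ne'
    (Filter.Eventually.of_forall (incomplete_amplitude h0 h1))
  rwa [integrand_amplitude h0 h1, inv_div] at h

theorem hasDerivAt_angle (u : ℝ) :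
    HasDerivAt (angle κ) (κ * cos (amplitude κ u) / cos (angle κ u / 2)) u := by
  have hlt := abs_lt.1 (abs_mul_sin_lt_one h0 h1 (amplitude κ u))
  have h := (hasDerivAt_arcsin hlt.1.ne' hlt.2.ne).comp u
    (((hasDerivAt_amplitude h0 h1 u).sin).const_mul κ)
  refine h.congr_deriv ?_
  have hc := cos_angle_pos h0 h1 u
  have hc2 := cos_half_angle_pos h0 h1 u
  -- The square root in the derivative of `arcsin` is `cos ψ`, which cancels the numerator of `φ'`.
  rw [← cos_arcsin, ← angle]
  field_simp

/-- The derivative of `d κ`. -/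
theorem hasDerivAt_d (u : ℝ) :
    HasDerivAt (d κ) (-2 * κ * (sin (angle κ u / 2) * cos (amplitude κ u))) u := by
  refine (hasDerivAt_angle h0 h1 u).cos.congr_deriv ?_
  have hc2 := cos_half_angle_pos h0 h1 u
  have hsin : sin (angle κ u) = 2 * sin (angle κ u / 2) * cos (angle κ u / 2) := by
    rw [← sin_two_mul]; ring_nf
  rw [hsin]
  field_simp

/-- This is the derivative of `d'² = 2(1 - d)(d² - λ²)` after division by `2d'`. The direct
computation stays valid where `d' = 0`. -/
theorem hasDerivAt_deriv_d (u : ℝ) :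
    HasDerivAt (fun u => -2 * κ * (sin (angle κ u / 2) * cos (amplitude κ u)))
      (2 * d κ u * (1 - d κ u) - (d κ u ^ 2 - (1 - κ ^ 2))) u := by
  have h := ((((hasDerivAt_angle h0 h1 u).div_const 2).sin).mul
    (hasDerivAt_amplitude h0 h1 u).cos).const_mul (-2 * κ)
  refine h.congr_deriv ?_
  have hc2 := cos_half_angle_pos h0 h1 u
  have hsin : κ * sin (amplitude κ u) = 2 * sin (angle κ u / 2) * cos (angle κ u / 2) := by
    rw [← sin_two_mul, ← sin_angle h0 h1]; ring_nf
  have hcos : cos (angle κ u) = cos (angle κ u / 2) ^ 2 - sin (angle κ u / 2) ^ 2 := by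
    rw [← cos_two_mul']; ring_nf
  have e1 := sin_sq_add_cos_sq (angle κ u / 2)
  have e2 := sin_sq_add_cos_sq (amplitude κ u)
  simp only [d]
  rw [hcos]
  generalize sin (angle κ u / 2) = s at *
  generalize cos (angle κ u / 2) = c at *
  generalize sin (amplitude κ u) = S at *
  generalize cos (amplitude κ u) = C at *
  have hs : s ^ 2 = 1 - c ^ 2 := by linarith
  -- `κ² cos² φ = κ² - sin² ψ`, with `sin ψ = 2sc`.
  have hC : κ ^ 2 * C ^ 2 = κ ^ 2 - 4 * s ^ 2 * c ^ 2 := by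
    linear_combination κ ^ 2 * e2 - (κ * S + 2 * s * c) * hsin
  have hlhs : -2 * κ * (c * (κ * C / c / 2) * C + s * (-S * ((c ^ 2 - s ^ 2) / c))) =
      -(κ ^ 2 * C ^ 2) + 4 * s ^ 2 * (c ^ 2 - s ^ 2) := by
    field_simp
    linear_combination 2 * s * (c ^ 2 - s ^ 2) * hsin
  refine Eq.trans ?_ (hlhs.trans ?_)
  · ring
  · rw [hC, hs]
    ring

theorem amplitude_zero : amplitude κ 0 = 0 := by
  simpa [incomplete] using amplitude_incomplete h0 h1 0

theorem angle_zero : angle κ 0 = 0 := by simp [angle, amplitude_zero h0 h1]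

theorem d_zero : d κ 0 = 1 := by simp [d, angle_zero h0 h1]

end Amplitude

end Shen

/-! ### The second-order equation of `℘` -/

namespace PeriodPair

open Filter Topology

variable (L : PeriodPair)

theorem tendsto_weierstrassP_cobounded {l : ℂ} (hl : l ∈ L.lattice) :
    Tendsto L.weierstrassP (𝓝[≠] l) (Bornology.cobounded ℂ) := by
  rw [tendsto_cobounded_iff_meromorphicOrderAt_neg (L.meromorphic_weierstrassP l),
    L.order_weierstrassP l hl]
  decide

theorem isPreconnected_compl_lattice : IsPreconnected ((L.lattice : Set ℂ)ᶜ) :=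
  (Set.Countable.isConnected_compl_of_one_lt_rank (by simp)
    (Set.countable_coe_iff.1 (inferInstanceAs (Countable L.lattice)))).isPreconnected

theorem eventually_notMem_lattice (z : ℂ) : ∀ᶠ w in 𝓝[≠] z, w ∉ L.lattice := by
  filter_upwards [self_mem_nhdsWithin, mem_nhdsWithin_of_mem_nhds
    (L.compl_lattice_sdiff_singleton_mem_nhds z)] with w hw hw' hl
  exact hw' ⟨hl, hw⟩

theorem hasDerivAt_weierstrassP {z : ℂ} (hz : z ∉ L.lattice) :
    HasDerivAt L.weierstrassP (L.derivWeierstrassP z) z := by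
  rw [← deriv_weierstrassP]
  exact (L.analyticOnNhd_weierstrassP z hz).differentiableAt.hasDerivAt

/-- `℘'` does not vanish identically. -/
theorem not_eqOn_derivWeierstrassP_zero :
    ¬ Set.EqOn L.derivWeierstrassP 0 ((L.lattice : Set ℂ)ᶜ) := by
  intro h
  have hopen := L.isClosed_lattice.isOpen_compl
  -- If `℘' = 0`, then `℘` is constant on the connected complement of the lattice, which contradicts
  -- its pole at `0`.
  have hconst (z : ℂ) (hz : z ∉ L.lattice) : L.weierstrassP z = L.weierstrassP (L.ω₁ / 2) :=
    hopen.is_const_of_deriv_eq_zero L.isPreconnected_compl_lattice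
      (fun w hw => (L.hasDerivAt_weierstrassP hw).differentiableAt.differentiableWithinAt)
      (fun w hw => by rw [deriv_weierstrassP]; exact h hw) hz L.ω₁_div_two_notMem_lattice
  have h1 : Tendsto L.weierstrassP (𝓝[≠] 0) (𝓝 (L.weierstrassP (L.ω₁ / 2))) := by
    refine tendsto_const_nhds.congr' ?_
    filter_upwards [L.eventually_notMem_lattice 0] with z hz using (hconst z hz).symm
  exact not_tendsto_nhds_of_tendsto_atTop
    (tendsto_norm_atTop_iff_cobounded.2 (L.tendsto_weierstrassP_cobounded (zero_mem _))) _ h1.norm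

/-- `℘'' = 6 ℘² - g₂ / 2`. -/
theorem hasDerivAt_derivWeierstrassP {z : ℂ} (hz : z ∉ L.lattice) :
    HasDerivAt L.derivWeierstrassP (6 * L.weierstrassP z ^ 2 - L.g₂ / 2) z := by
  have hopen := L.isClosed_lattice.isOpen_compl
  have hP := L.analyticOnNhd_weierstrassP
  have hP' := L.analyticOnNhd_derivWeierstrassP
  have hQ : AnalyticOnNhd ℂ (fun z => deriv L.derivWeierstrassP z -
      (6 * L.weierstrassP z ^ 2 - L.g₂ / 2)) ((L.lattice : Set ℂ)ᶜ) := fun w hw =>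
    ((hP' w hw).deriv).sub ((analyticAt_const.mul ((hP w hw).pow 2)).sub analyticAt_const)
  -- Differentiating `℘'² = 4℘³ - g₂℘ - g₃` gives the desired equation multiplied by `2℘'`.
  have hmul (w : ℂ) (hw : w ∈ (L.lattice : Set ℂ)ᶜ) : L.derivWeierstrassP w *
      (deriv L.derivWeierstrassP w - (6 * L.weierstrassP w ^ 2 - L.g₂ / 2)) = 0 := by
    have e1 := (hP' w hw).differentiableAt.hasDerivAt.pow 2
    have hp := L.hasDerivAt_weierstrassP hw
    have e2 := (((hp.pow 3).const_mul 4).sub (hp.const_mul L.g₂)).sub_const L.g₃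
    have e3 := e1.congr_of_eventuallyEq
      (f₁ := fun w => 4 * L.weierstrassP w ^ 3 - L.g₂ * L.weierstrassP w - L.g₃) (by
        filter_upwards [hopen.mem_nhds hw] with v hv
        exact (L.derivWeierstrassP_sq v hv).symm)
    have e4 := e3.unique e2
    norm_num at e4
    linear_combination e4 / 2
  -- Analytic functions on a connected set have no zero divisors, so `℘'` can be cancelled, even at
  -- its zeros.
  have h := (hP'.eq_zero_or_eq_zero_of_mul_eq_zero hQ hmul L.isPreconnected_compl_lattice).resolve_left
    L.not_eqOn_derivWeierstrassP_zero
  have hz' := h z hz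
  rw [← sub_eq_zero.1 hz']
  exact (hP' z hz).differentiableAt.hasDerivAt

end PeriodPair

/-! ### Uniqueness for the differential equation -/

namespace Shen

open Filter Topology

/-- Local uniqueness for the autonomous second order equation `x'' = Q x` in `ℂ`. -/
theorem eventuallyEq_of_second_order {Q : ℂ → ℂ} (hQ : ContDiff ℝ 1 Q) {f f' g g' : ℝ → ℂ} {t₀ : ℝ}
    (hf : ∀ᶠ t in 𝓝 t₀, HasDerivAt f (f' t) t ∧ HasDerivAt f' (Q (f t)) t)
    (hg : ∀ᶠ t in 𝓝 t₀, HasDerivAt g (g' t) t ∧ HasDerivAt g' (Q (g t)) t)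
    (h : f t₀ = g t₀) (h' : f' t₀ = g' t₀) : f =ᶠ[𝓝 t₀] g := by
  -- The first-order system `(x, x')' = (x', Q x)` has a `C¹`, hence locally Lipschitz, field.
  have hv : ContDiff ℝ 1 fun p : ℂ × ℂ => (p.2, Q p.1) :=
    contDiff_snd.prodMk (hQ.comp contDiff_fst)
  obtain ⟨K, s, hs, hK⟩ := (hv.contDiffAt (x := (f t₀, f' t₀))).exists_lipschitzOnWith
  have mem {x x' : ℝ → ℂ} (hx : ∀ᶠ t in 𝓝 t₀, HasDerivAt x (x' t) t ∧ HasDerivAt x' (Q (x t)) t)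
      (h0 : (x t₀, x' t₀) = (f t₀, f' t₀)) :
      ∀ᶠ t in 𝓝 t₀, HasDerivAt (fun t => (x t, x' t)) (x' t, Q (x t)) t ∧ (x t, x' t) ∈ s := by
    have hc : ContinuousAt (fun t => (x t, x' t)) t₀ :=
      (hx.self_of_nhds.1.prodMk hx.self_of_nhds.2).continuousAt
    have hmem := hc.eventually_mem (h0 ▸ hs)
    filter_upwards [hx, hmem] with t h1 h2 using ⟨h1.1.prodMk h1.2, h2⟩
  have := ODE_solution_unique_of_eventually (v := fun _ p => (p.2, Q p.1)) (s := fun _ => s)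
    (Eventually.of_forall fun _ => hK) (mem hf rfl) (mem hg (by rw [h, h'])) (by rw [h, h'])
  filter_upwards [this] with t ht using congrArg Prod.fst ht

/-! ### `dn₂` as an elliptic function -/

section

variable {κ : ℝ} {L : PeriodPair}

theorem dn₂_of_mem {z : ℂ} (hz : z ∈ L.lattice) : dn₂ κ L z = 1 := if_pos hz

theorem dn₂_of_notMem {z : ℂ} (hz : z ∉ L.lattice) :
    dn₂ κ L z = 1 - ((κ : ℂ) ^ 2 / 2) / (1 / 3 + L.weierstrassP z) := if_neg hz

theorem dn₂_add_coe {l : ℂ} (hl : l ∈ L.lattice) (z : ℂ) : dn₂ κ L (z + l) = dn₂ κ L z := by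
  have h : z + l ∈ L.lattice ↔ z ∈ L.lattice := L.lattice.toAddSubgroup.add_mem_cancel_right hl
  have hP : L.weierstrassP (z + l) = L.weierstrassP z := L.weierstrassP_add_coe z ⟨l, hl⟩
  by_cases hz : z ∈ L.lattice
  · rw [dn₂_of_mem hz, dn₂_of_mem (h.2 hz)]
  · rw [dn₂_of_notMem hz, dn₂_of_notMem (mt h.1 hz), hP]

/-- Evenness supplies the initial condition `dn₂'(0) = 0`. -/
theorem dn₂_neg (z : ℂ) : dn₂ κ L (-z) = dn₂ κ L z := by
  by_cases hz : z ∈ L.lattice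
  · rw [dn₂_of_mem hz, dn₂_of_mem (neg_mem hz)]
  · rw [dn₂_of_notMem hz, dn₂_of_notMem (mt neg_mem_iff.1 hz), L.weierstrassP_neg]

theorem eventuallyEq_dn₂ (z : ℂ) :
    dn₂ κ L =ᶠ[𝓝[≠] z] fun w => 1 - ((κ : ℂ) ^ 2 / 2) / (1 / 3 + L.weierstrassP w) := by
  filter_upwards [L.eventually_notMem_lattice z] with w hw using dn₂_of_notMem hw

theorem isElliptic_dn₂ : IsElliptic L (dn₂ κ L) := by
  refine ⟨fun z => ?_, fun l hl z => dn₂_add_coe hl z⟩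
  refine MeromorphicAt.congr ?_ (eventuallyEq_dn₂ z).symm
  have := L.meromorphic_weierstrassP z
  fun_prop

theorem analyticAt_dn₂_of_mem {l : ℂ} (hl : l ∈ L.lattice) : AnalyticAt ℂ (dn₂ κ L) l := by
  have hE := L.analyticAt_weierstrassPExcept l
  -- Numerator and denominator are multiplied by `(z - l)²`, which clears the double pole of `℘`;
  -- the new denominator is `1` at `l`. For `l = 0` the term `1 / l ^ 2` is `0`, as it should be.
  have h : dn₂ κ L =ᶠ[𝓝 l] fun z => 1 - ((κ : ℂ) ^ 2 / 2) * (z - l) ^ 2 /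
      (1 + (z - l) ^ 2 * (1 / 3 + L.weierstrassPExcept l z - 1 / l ^ 2)) := by
    filter_upwards [L.compl_lattice_sdiff_singleton_mem_nhds l] with z hz
    by_cases hzl : z = l
    · simp [hzl, dn₂_of_mem hl]
    · have hz' : z ∉ L.lattice := fun h => hz ⟨h, hzl⟩
      have hzl' : z - l ≠ 0 := sub_ne_zero.2 hzl
      rw [dn₂_of_notMem hz', ← L.weierstrassPExcept_add ⟨l, hl⟩ z,
        show (1 : ℂ) + (z - l) ^ 2 * (1 / 3 + L.weierstrassPExcept l z - 1 / l ^ 2) =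
          (z - l) ^ 2 * (1 / 3 + (L.weierstrassPExcept l z + (1 / (z - l) ^ 2 - 1 / l ^ 2))) by
            field_simp; ring,
        mul_comm ((κ : ℂ) ^ 2 / 2), mul_div_mul_left _ _ (pow_ne_zero 2 hzl')]
  refine AnalyticAt.congr ?_ h.symm
  refine analyticAt_const.sub (AnalyticAt.div (by fun_prop) ?_ (by simp))
  fun_prop

theorem analyticAt_dn₂_of_notMem {z : ℂ} (hz : z ∉ L.lattice)
    (hq : 1 / 3 + L.weierstrassP z ≠ 0) : AnalyticAt ℂ (dn₂ κ L) z := by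
  have hP := L.analyticOnNhd_weierstrassP z hz
  refine AnalyticAt.congr (f := fun w => 1 - ((κ : ℂ) ^ 2 / 2) / (1 / 3 + L.weierstrassP w)) ?_ ?_
  · exact analyticAt_const.sub (analyticAt_const.div (analyticAt_const.add hP) hq)
  · filter_upwards [L.isClosed_lattice.isOpen_compl.mem_nhds hz] with w hw
    exact (dn₂_of_notMem hw).symm

theorem compl_sq (h0 : 0 < κ) (h1 : κ < 1) : (compl κ : ℂ) ^ 2 = 1 - (κ : ℂ) ^ 2 := by
  have h : compl κ ^ 2 = 1 - κ ^ 2 := Real.sq_sqrt (by nlinarith)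
  exact_mod_cast congrArg ((↑) : ℝ → ℂ) h

variable (κ) in
/-- The right-hand side of the differential equation `x'' = dnField x` of `dn₂` and `d`. -/
noncomputable def dnField (x : ℂ) : ℂ := 2 * x * (1 - x) - (x ^ 2 - (1 - (κ : ℂ) ^ 2))

theorem contDiff_dnField : ContDiff ℝ 1 (dnField κ) := by
  unfold dnField
  fun_prop

/-! ### The differential equation of `dn₂` -/

variable (h0 : 0 < κ) (h1 : κ < 1) (hL : HasInvariants κ L)
include h0 h1 hL

theorem hasDerivAt_deriv_dn₂_of_notMem {z : ℂ} (hz : z ∉ L.lattice)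
    (hq : 1 / 3 + L.weierstrassP z ≠ 0) :
    HasDerivAt (deriv (dn₂ κ L)) (dnField κ (dn₂ κ L z)) z := by
  have hd {w : ℂ} (hw : w ∉ L.lattice) (hqw : 1 / 3 + L.weierstrassP w ≠ 0) :
      HasDerivAt (dn₂ κ L) (((κ : ℂ) ^ 2 / 2) * L.derivWeierstrassP w /
        (1 / 3 + L.weierstrassP w) ^ 2) w := by
    have h := ((hasDerivAt_const w ((κ : ℂ) ^ 2 / 2)).div
      ((L.hasDerivAt_weierstrassP hw).const_add (1 / 3)) hqw).const_sub 1
    refine (h.congr_of_eventuallyEq ?_).congr_deriv ?_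
    · filter_upwards [L.isClosed_lattice.isOpen_compl.mem_nhds hw] with v hv
      exact dn₂_of_notMem hv
    · ring
  have hev : deriv (dn₂ κ L) =ᶠ[𝓝 z] fun w => ((κ : ℂ) ^ 2 / 2) * L.derivWeierstrassP w /
        (1 / 3 + L.weierstrassP w) ^ 2 := by
    have hc := ((L.analyticOnNhd_weierstrassP z hz).continuousAt.const_add (1 / 3)).eventually_ne hq
    filter_upwards [L.isClosed_lattice.isOpen_compl.mem_nhds hz, hc] with w hw hqw
    exact (hd hw hqw).deriv
  have h := ((L.hasDerivAt_derivWeierstrassP hz).const_mul ((κ : ℂ) ^ 2 / 2)).div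
    (((L.hasDerivAt_weierstrassP hz).const_add (1 / 3)).pow 2) (pow_ne_zero 2 hq)
  refine (h.congr_of_eventuallyEq hev).congr_deriv ?_
  have hsq := L.derivWeierstrassP_sq z hz
  have hg2 := hL.1
  have hg3 := hL.2
  rw [compl_sq h0 h1] at hg2 hg3
  rw [hg2, hg3] at hsq
  rw [dn₂_of_notMem hz, dnField, hg2]
  -- In terms of `q` the relations are `q'² = 4q³ - 4q² + κ²q` and `q'' = 6q² - 4q + κ²/2`; both
  -- sides of the goal become polynomials in `1/q`.
  obtain ⟨q, hqe⟩ : ∃ q, q = 1 / 3 + L.weierstrassP z := ⟨_, rfl⟩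
  have hP : L.weierstrassP z = q - 1 / 3 := by rw [hqe]; ring
  rw [← hqe] at hq ⊢
  simp only [Pi.pow_apply, ← hqe]
  rw [hP] at hsq ⊢
  have hnum : ∀ A B : ℂ, (A * B * q ^ 2 - A * L.derivWeierstrassP z *
      (2 * q * L.derivWeierstrassP z)) / (q ^ 2) ^ 2 =
      A * B / q ^ 2 - 2 * A * L.derivWeierstrassP z ^ 2 / q ^ 3 := by
    intro A B
    field_simp
  norm_num
  rw [hnum, hsq]
  field_simp
  ring

omit h0 h1 hL in
theorem eventually_ne_zero_of_mem {l : ℂ} (hl : l ∈ L.lattice) :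
    ∀ᶠ w in 𝓝[≠] l, 1 / 3 + L.weierstrassP w ≠ 0 := by
  have h := (tendsto_norm_atTop_iff_cobounded.2
    (L.tendsto_weierstrassP_cobounded hl)).eventually_gt_atTop 1
  filter_upwards [h] with w hw h0
  rw [eq_neg_of_add_eq_zero_right h0] at hw
  norm_num at hw

/-- If `℘` were `-1/3` near `z`, then `℘'' = 0` there, whereas `6℘² - g₂/2` would equal `κ²/2`. -/
theorem eventually_ne_zero_of_notMem {z : ℂ} (hz : z ∉ L.lattice) :
    ∀ᶠ w in 𝓝[≠] z, 1 / 3 + L.weierstrassP w ≠ 0 := by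
  have hA : AnalyticAt ℂ (fun w => 1 / 3 + L.weierstrassP w) z :=
    analyticAt_const.add (L.analyticOnNhd_weierstrassP z hz)
  refine hA.eventually_eq_zero_or_eventually_ne_zero.resolve_left fun h => ?_
  have hP : L.derivWeierstrassP =ᶠ[𝓝 z] fun _ => 0 := by
    filter_upwards [h.eventually_nhds, L.isClosed_lattice.isOpen_compl.mem_nhds hz] with w hw hwL
    have := (EventuallyEq.deriv_eq (f₁ := fun w => 1 / 3 + L.weierstrassP w) (f := fun _ => 0) hw)
    rw [((L.hasDerivAt_weierstrassP hwL).const_add _).deriv] at this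
    simpa using this
  have h2 := (L.hasDerivAt_derivWeierstrassP hz).unique
    ((hasDerivAt_const z (0 : ℂ)).congr_of_eventuallyEq hP)
  have h3 : L.weierstrassP z = -1 / 3 := by linear_combination h.self_of_nhds
  have hκ : (κ : ℂ) ^ 2 = 0 := by
    rw [h3, hL.1, compl_sq h0 h1] at h2
    linear_combination 2 * h2
  exact h0.ne' (by exact_mod_cast pow_eq_zero_iff two_ne_zero |>.1 hκ)

/-- The equation holds on a punctured neighbourhood of `l`, and both sides are continuous at `l`. -/
theorem hasDerivAt_deriv_dn₂_of_mem {l : ℂ} (hl : l ∈ L.lattice) :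
    HasDerivAt (deriv (dn₂ κ L)) (dnField κ (dn₂ κ L l)) l := by
  have hA := analyticAt_dn₂_of_mem (κ := κ) hl
  have h : deriv (deriv (dn₂ κ L)) =ᶠ[𝓝[≠] l] fun z => dnField κ (dn₂ κ L z) := by
    filter_upwards [L.eventually_notMem_lattice l, eventually_ne_zero_of_mem hl] with z hz hq
    exact (hasDerivAt_deriv_dn₂_of_notMem h0 h1 hL hz hq).deriv
  have hcont : ContinuousAt (fun z => dnField κ (dn₂ κ L z)) l :=
    ContinuousAt.comp (contDiff_dnField (κ := κ)).continuous.continuousAt hA.continuousAt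
  have h' := (hA.deriv.deriv.continuousAt.eventuallyEq_nhds_iff_eventuallyEq_nhdsNE hcont).1 h
  rw [show dnField κ (dn₂ κ L l) = _ from h'.self_of_nhds.symm]
  exact hA.deriv.differentiableAt.hasDerivAt

/-- A point at which `dn₂` is holomorphic for an evident reason has a neighbourhood in which `dn₂`
solves the differential equation. -/
theorem eventually_hasDerivAt_dn₂ {z : ℂ} (hz : z ∈ L.lattice ∨ 1 / 3 + L.weierstrassP z ≠ 0) :
    AnalyticAt ℂ (dn₂ κ L) z ∧ ∀ᶠ w in 𝓝 z, HasDerivAt (dn₂ κ L) (deriv (dn₂ κ L) w) w ∧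
      HasDerivAt (deriv (dn₂ κ L)) (dnField κ (dn₂ κ L w)) w := by
  have hA : AnalyticAt ℂ (dn₂ κ L) z := by
    by_cases hzL : z ∈ L.lattice
    · exact analyticAt_dn₂_of_mem hzL
    · exact analyticAt_dn₂_of_notMem hzL (hz.resolve_left hzL)
  refine ⟨hA, ?_⟩
  have hev : ∀ᶠ w in 𝓝 z, w ∈ L.lattice ∨ 1 / 3 + L.weierstrassP w ≠ 0 := by
    by_cases hzL : z ∈ L.lattice
    · filter_upwards [eventually_nhdsWithin_iff.1 (eventually_ne_zero_of_mem hzL)] with w hw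
      by_cases hwz : w = z
      · exact Or.inl (hwz ▸ hzL)
      · exact Or.inr (hw hwz)
    · have hc := ((L.analyticOnNhd_weierstrassP z hzL).continuousAt.const_add
        (1 / 3)).eventually_ne (hz.resolve_left hzL)
      filter_upwards [hc] with w hw using Or.inr hw
  filter_upwards [hA.eventually_analyticAt, hev] with w hw hw'
  refine ⟨hw.differentiableAt.hasDerivAt, ?_⟩
  by_cases hwL : w ∈ L.lattice
  · exact hasDerivAt_deriv_dn₂_of_mem h0 h1 hL hwL
  · exact hasDerivAt_deriv_dn₂_of_notMem h0 h1 hL hwL (hw'.resolve_left hwL)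

/-! ### Comparison of `dn₂` and `d` on the real line -/

omit h0 h1 hL in
theorem tendsto_ofReal_nhdsNE (u : ℝ) :
    Tendsto (fun v : ℝ => (v : ℂ)) (𝓝[≠] u) (𝓝[≠] (u : ℂ)) :=
  tendsto_nhdsWithin_of_tendsto_nhds_of_eventually_within _
    (Complex.continuous_ofReal.continuousAt.mono_left nhdsWithin_le_nhds)
    (eventually_mem_nhdsWithin.mono fun v hv => by simpa using hv)

omit hL in
theorem continuous_d : Continuous (d κ) :=
  continuous_iff_continuousAt.2 fun u => (hasDerivAt_d h0 h1 u).continuousAt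

/-- A real point at which `d` and `dn₂` agree arbitrarily closely is not a pole of `dn₂`. -/
theorem mul_eq_of_frequently_eq {u : ℝ} (hu : (u : ℂ) ∉ L.lattice)
    (h : ∃ᶠ v in 𝓝[≠] u, dn₂ κ L ((v : ℝ) : ℂ) = (d κ v : ℂ)) :
    (1 - (d κ u : ℂ)) * (1 / 3 + L.weierstrassP (u : ℂ)) = (κ : ℂ) ^ 2 / 2 := by
  have hc : ContinuousAt (fun v : ℝ => (1 - (d κ v : ℂ)) * (1 / 3 + L.weierstrassP (v : ℂ))) u := by
    have hP : ContinuousAt (fun v : ℝ => L.weierstrassP (v : ℂ)) u :=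
      ContinuousAt.comp (L.analyticOnNhd_weierstrassP _ hu).continuousAt
        Complex.continuous_ofReal.continuousAt
    have := continuous_d h0 h1
    exact ContinuousAt.mul (by fun_prop) (hP.const_add _)
  refine tendsto_nhds_unique_of_frequently_eq (hc.mono_left nhdsWithin_le_nhds) tendsto_const_nhds
    (l := 𝓝[≠] u) ?_
  -- The formula for `dn₂` can be solved for the product only off the lattice and where `1/3 + ℘ ≠
  -- 0`; both hold at all `v ≠ u` near `u`.
  have ht := tendsto_ofReal_nhdsNE u
  refine (h.and_eventually ((ht.eventually (L.eventually_notMem_lattice u)).and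
    (ht.eventually (eventually_ne_zero_of_notMem h0 h1 hL hu)))).mono ?_
  rintro v ⟨hv, hvL, hq⟩
  rw [← hv, dn₂_of_notMem hvL, sub_sub_cancel, div_mul_cancel₀ _ hq]

theorem eventuallyEq_dn₂_d {u : ℝ} (hu : (u : ℂ) ∈ L.lattice ∨ 1 / 3 + L.weierstrassP (u : ℂ) ≠ 0)
    (h : dn₂ κ L (u : ℂ) = (d κ u : ℂ))
    (h' : deriv (dn₂ κ L) (u : ℂ) = ((deriv (d κ) u : ℝ) : ℂ)) :
    (fun v : ℝ => dn₂ κ L (v : ℂ)) =ᶠ[𝓝 u] fun v : ℝ => ((d κ v : ℝ) : ℂ) := by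
  have hderiv : deriv (d κ) = fun u => -2 * κ * (Real.sin (angle κ u / 2) *
    Real.cos (amplitude κ u)) := funext fun u => (hasDerivAt_d h0 h1 u).deriv
  refine eventuallyEq_of_second_order (contDiff_dnField (κ := κ))
    (f' := fun v : ℝ => deriv (dn₂ κ L) (v : ℂ)) (g' := fun v : ℝ => ((deriv (d κ) v : ℝ) : ℂ))
    ?_ ?_ h h'
  · have := (Complex.continuous_ofReal.tendsto u).eventually
      (eventually_hasDerivAt_dn₂ h0 h1 hL hu).2
    filter_upwards [this] with v hv using ⟨hv.1.comp_ofReal, hv.2.comp_ofReal⟩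
  · refine Eventually.of_forall fun v => ⟨?_, ?_⟩
    · rw [(hasDerivAt_d h0 h1 v).deriv]
      exact (hasDerivAt_d h0 h1 v).ofReal_comp
    · rw [hderiv]
      refine (hasDerivAt_deriv_d h0 h1 v).ofReal_comp.congr_deriv ?_
      simp [dnField]

/-- The set of points near which the two functions agree is open by construction, contains `0`, and
is closed: at a limit point `dn₂` is regular, values and derivatives agree by continuity, and local
uniqueness applies. -/
theorem eventuallyEq_dn₂_d_all (u : ℝ) :
    (fun v : ℝ => dn₂ κ L (v : ℂ)) =ᶠ[𝓝 u] fun v : ℝ => ((d κ v : ℝ) : ℂ) := by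
  set A : Set ℝ := {u | (fun v : ℝ => dn₂ κ L (v : ℂ)) =ᶠ[𝓝 u] fun v : ℝ => ((d κ v : ℝ) : ℂ)} with hAdef
  have hderiv : deriv (d κ) = fun u => -2 * κ * (Real.sin (angle κ u / 2) *
    Real.cos (amplitude κ u)) := funext fun u => (hasDerivAt_d h0 h1 u).deriv
  have hopen : IsOpen A := isOpen_iff_mem_nhds.2 fun u hu => eventually_eventually_nhds.2 hu
  have hclosed : IsClosed A := by
    refine isClosed_iff_frequently.2 fun u hfr => ?_
    by_contra huA
    have hfr' : ∃ᶠ v in 𝓝[≠] u, v ∈ A := by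
      rw [frequently_nhdsWithin_iff]
      exact hfr.mono fun v hv => ⟨hv, fun h => huA (h ▸ hv)⟩
    have heq : ∃ᶠ v in 𝓝[≠] u, dn₂ κ L ((v : ℝ) : ℂ) = (d κ v : ℂ) :=
      hfr'.mono fun v hv => EventuallyEq.eq_of_nhds hv
    -- Off the lattice the limiting identity `(1 - d)(1/3 + ℘) = κ²/2 ≠ 0` excludes a pole of `dn₂`.
    have hreg : (u : ℂ) ∈ L.lattice ∨ 1 / 3 + L.weierstrassP (u : ℂ) ≠ 0 := by
      by_cases huL : (u : ℂ) ∈ L.lattice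
      · exact Or.inl huL
      · refine Or.inr fun h => ?_
        have := mul_eq_of_frequently_eq h0 h1 hL huL heq
        rw [h, mul_zero] at this
        have hκ : (κ : ℂ) ≠ 0 := by exact_mod_cast h0.ne'
        exact div_ne_zero (pow_ne_zero 2 hκ) two_ne_zero this.symm
    obtain ⟨han, hev⟩ := eventually_hasDerivAt_dn₂ h0 h1 hL hreg
    have hof : ContinuousAt (fun v : ℝ => (v : ℂ)) u := Complex.continuous_ofReal.continuousAt
    refine huA (eventuallyEq_dn₂_d h0 h1 hL hreg ?_ ?_)
    · refine tendsto_nhds_unique_of_frequently_eq (l := 𝓝[≠] u)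
        ((ContinuousAt.comp (f := fun v : ℝ => (v : ℂ)) han.continuousAt hof).mono_left
          nhdsWithin_le_nhds)
        (((Complex.continuous_ofReal.comp (continuous_d h0 h1)).tendsto u).mono_left
          nhdsWithin_le_nhds) heq
    · refine tendsto_nhds_unique_of_frequently_eq (l := 𝓝[≠] u)
        ((ContinuousAt.comp (f := fun v : ℝ => (v : ℂ)) han.deriv.continuousAt hof).mono_left
          nhdsWithin_le_nhds)
        (g := fun v : ℝ => ((deriv (d κ) v : ℝ) : ℂ)) (((Complex.continuous_ofReal.continuousAt.comp
          (f := deriv (d κ)) ?_).tendsto).mono_left nhdsWithin_le_nhds) ?_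
      · rw [hderiv]
        exact (hasDerivAt_deriv_d h0 h1 u).continuousAt
      · refine (hfr'.and_eventually ((hof.eventually hev).filter_mono nhdsWithin_le_nhds)).mono ?_
        rintro v ⟨hv, hv1, -⟩
        have e1 := hv1.comp_ofReal.congr_of_eventuallyEq (EventuallyEq.symm hv)
        have e2 := (hasDerivAt_d h0 h1 v).ofReal_comp
        rw [← (hasDerivAt_d h0 h1 v).deriv] at e2
        exact e1.unique e2
  have hzero : (0 : ℝ) ∈ A := by
    have hmem : ((0 : ℝ) : ℂ) ∈ L.lattice := by simp
    refine eventuallyEq_dn₂_d h0 h1 hL (Or.inl hmem) ?_ ?_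
    · rw [dn₂_of_mem hmem, d_zero h0 h1, Complex.ofReal_one]
    · have hn : (fun z => dn₂ κ L (-z)) = dn₂ κ L := funext dn₂_neg
      have h2 := deriv_comp_neg (dn₂ κ L) 0
      rw [hn, neg_zero] at h2
      rw [(hasDerivAt_d h0 h1 0).deriv]
      simp only [angle_zero h0 h1, zero_div, Real.sin_zero, zero_mul, mul_zero, Complex.ofReal_zero]
      exact self_eq_neg.1 h2
  have huniv := IsClopen.eq_univ ⟨hclosed, hopen⟩ ⟨0, hzero⟩
  exact (huniv ▸ Set.mem_univ u : u ∈ A)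

theorem dn₂_ofReal (u : ℝ) : dn₂ κ L (u : ℂ) = (d κ u : ℂ) :=
  (eventuallyEq_dn₂_d_all h0 h1 hL u).eq_of_nhds

theorem one_sub_d_mul {u : ℝ} (hu : (u : ℂ) ∉ L.lattice) :
    (1 - (d κ u : ℂ)) * (1 / 3 + L.weierstrassP (u : ℂ)) = (κ : ℂ) ^ 2 / 2 :=
  mul_eq_of_frequently_eq h0 h1 hL hu (Frequently.of_forall (dn₂_ofReal h0 h1 hL))

theorem analyticAt_dn₂_ofReal (u : ℝ) : AnalyticAt ℂ (dn₂ κ L) (u : ℂ) := by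
  by_cases hu : (u : ℂ) ∈ L.lattice
  · exact analyticAt_dn₂_of_mem hu
  · refine analyticAt_dn₂_of_notMem hu fun h => ?_
    have := one_sub_d_mul h0 h1 hL hu
    rw [h, mul_zero] at this
    have hκ : (κ : ℂ) ≠ 0 := by exact_mod_cast h0.ne'
    exact div_ne_zero (pow_ne_zero 2 hκ) two_ne_zero this.symm

end

end Shen

/-! ### Existence of the lattice, by Eisenstein series -/

namespace Shen

open Filter Topology Complex ModularForm EisensteinSeries
open UpperHalfPlane hiding I

theorem bernoulli_six : bernoulli 6 = 1 / 42 := by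
  have h5 : bernoulli' 5 = 0 := bernoulli'_eq_zero_of_odd (by decide) (by norm_num)
  rw [bernoulli_eq_bernoulli'_of_ne_one (by decide), bernoulli'_def]
  norm_num [Finset.sum_range_succ, Nat.choose, h5]

theorem bernoulli_four : bernoulli 4 = -1 / 30 := by
  rw [bernoulli_eq_bernoulli'_of_ne_one (by decide)]
  norm_num

theorem riemannZeta_six : riemannZeta 6 = (Real.pi : ℂ) ^ 6 / 945 := by
  have h := riemannZeta_two_mul_nat (k := 3) (by norm_num)
  norm_num [bernoulli_six, Nat.factorial] at h
  rw [h]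
  ring

/-- The period pair `(cτ, c)`. -/
noncomputable def periodPairOfTau (τ : ℍ) (c : ℂ) (hc : c ≠ 0) : PeriodPair where
  ω₁ := c * τ
  ω₂ := c
  indep := by
    rw [LinearIndependent.pair_iff]
    intro s t h
    simp only [Complex.real_smul] at h
    have h' : (s : ℂ) * τ + t = 0 := by
      have : c * ((s : ℂ) * τ + t) = 0 := by linear_combination h
      exact (mul_eq_zero.1 this).resolve_left hc
    have him : s * τ.im = 0 := by simpa using congrArg Complex.im h'
    have hs : s = 0 := (mul_eq_zero.1 him).resolve_right τ.im_pos.ne'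
    refine ⟨hs, ?_⟩
    simpa [hs] using h'

/-- Grouping the pairs of integers by their gcd turns the lattice sum into `ζ(k)` times a sum over
coprime pairs, which is `2E_k`. The term of the zero vector is `0⁻¹ = 0`. -/
theorem G_periodPairOfTau (τ : ℍ) (c : ℂ) (hc : c ≠ 0) {k : ℕ} (hk : 3 ≤ k) :
    (periodPairOfTau τ c hc).G k = (c ^ k)⁻¹ * (2 * riemannZeta k * E hk τ) := by
  have hE : 2 * E hk τ = eisensteinSeries (N := 1) 0 k τ := by
    rw [show E hk τ = (1 / 2 : ℂ) • eisensteinSeriesSIF (N := 1) 0 k τ from rfl,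
      eisensteinSeriesSIF_apply 0 k τ, smul_eq_mul]
    ring
  rw [mul_right_comm, hE, mul_comm _ (riemannZeta k),
    ← tsum_eisSummand_eq_riemannZeta_mul_eisensteinSeries hk τ, ← tsum_mul_left, PeriodPair.G,
    ← (periodPairOfTau τ c hc).latticeEquivProd.symm.toEquiv.tsum_eq,
    ← (finTwoArrowEquiv ℤ).tsum_eq]
  refine tsum_congr fun v => ?_
  change (((periodPairOfTau τ c hc).latticeEquivProd.symm (v 0, v 1)).1 ^ k)⁻¹ = _
  rw [PeriodPair.latticeEquiv_symm_apply]
  simp only [periodPairOfTau, eisSummand, zpow_neg, zpow_natCast]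
  rw [← mul_inv, ← mul_pow]
  congr 2
  ring

/-- At `τ = it` the nome `exp (2πiτ) = exp (-2πt)` is real, and so is the `q`-expansion. -/
theorem E_I_mul_eq_ofReal {k : ℕ} (hk : 3 ≤ k) (hk2 : Even k) {t : ℝ} (ht : 0 < t) :
    E hk (ofComplex (I * t)) = ((1 - (2 * k / (bernoulli k : ℝ)) * ∑' n : ℕ+,
      (ArithmeticFunction.sigma (k - 1) n : ℝ) * Real.exp (-2 * Real.pi * t) ^ (n : ℕ) : ℝ) : ℂ) := by
  have hexp : cexp (2 * Real.pi * I * (ofComplex (I * t) : ℍ)) =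
      ((Real.exp (-2 * Real.pi * t) : ℝ) : ℂ) := by
    rw [ofComplex_apply_of_im_pos (by simpa using ht), UpperHalfPlane.coe_mk, Complex.ofReal_exp]
    congr 1
    push_cast
    linear_combination 2 * Real.pi * t * I_mul_I
  rw [q_expansion_bernoulli hk hk2, hexp]
  push_cast
  simp [zpow_natCast]

theorem ofReal_re_E {k : ℕ} (hk : 3 ≤ k) (hk2 : Even k) {t : ℝ} (ht : 0 < t) :
    ((E hk (ofComplex (I * t))).re : ℂ) = E hk (ofComplex (I * t)) := by
  rw [E_I_mul_eq_ofReal hk hk2 ht, Complex.ofReal_re]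

/-- Since `B₄ < 0`, the expansion `1 + 240 ∑ σ₃(n) qⁿ` has positive coefficients. -/
theorem one_le_re_E₄ {t : ℝ} (ht : 0 < t) : 1 ≤ (E₄ (ofComplex (I * t))).re := by
  rw [E₄, E_I_mul_eq_ofReal _ (by decide) ht, Complex.ofReal_re, bernoulli_four]
  have : 0 ≤ ∑' n : ℕ+, (ArithmeticFunction.sigma (4 - 1) n : ℝ) *
      Real.exp (-2 * Real.pi * t) ^ (n : ℕ) := tsum_nonneg fun n => by positivity
  norm_num at this ⊢
  linarith

/-- `S : τ ↦ -1/τ` fixes `i`, and the weight-six factor there is `i⁶ = -1`. -/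
theorem E₆_I : E₆ (ofComplex (I * (1 : ℝ))) = 0 := by
  have : SlashInvariantFormClass (ModularForm (MonoidHom.range
    (Matrix.SpecialLinearGroup.mapGL (n := Fin 2) (R := ℤ) ℝ)) 6) (CongruenceSubgroup.Gamma 1) 6 :=
    CongruenceSubgroup.Gamma_one_coe_eq_SL ▸ inferInstance
  have h := SlashInvariantForm.slash_action_eqn_SL'' E₆
    (CongruenceSubgroup.mem_Gamma_one ModularGroup.S) UpperHalfPlane.I
  have hI : ModularGroup.S • UpperHalfPlane.I = UpperHalfPlane.I := by
    rw [modular_S_smul]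
    ext
    simp
  have hI' : ofComplex (I * (1 : ℝ)) = UpperHalfPlane.I := by
    ext
    rw [ofComplex_apply_of_im_pos (by simp)]
    simp
  rw [hI, ModularGroup.denom_S] at h
  rw [hI']
  have h6 : ((UpperHalfPlane.I : ℍ) : ℂ) ^ (6 : ℤ) = -1 := by
    rw [UpperHalfPlane.coe_I, show (6 : ℤ) = ((6 : ℕ) : ℤ) from rfl, zpow_natCast,
      show (6 : ℕ) = 2 * 3 by norm_num, pow_mul, I_sq]
    norm_num
  rw [h6, neg_one_mul] at h
  exact self_eq_neg.1 h

theorem tendsto_re_E {k : ℕ} (hk : 3 ≤ k) (hk2 : Even k) :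
    Tendsto (fun t : ℝ => (E hk (ofComplex (I * t))).re) atTop (𝓝 1) := by
  have h0 : Tendsto (fun t : ℝ => ofComplex (I * t)) atTop atImInfty := by
    rw [atImInfty, tendsto_comap_iff]
    refine tendsto_id.congr' ?_
    filter_upwards [eventually_gt_atTop 0] with t ht
    simp [ofComplex_apply_of_im_pos, ht, ← coe_im]
  have h1 : Tendsto (E hk) atImInfty (𝓝 1) := by
    have hA := ModularFormClass.analyticAt_cuspFunction_zero (E hk) one_pos one_mem_strictPeriods_SL
    have hv : cuspFunction 1 (E hk) 0 = 1 := by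
      simpa [qExpansion_coeff] using E_qExpansion_coeff_zero hk hk2
    rw [← hv]
    exact (hA.continuousAt.tendsto.comp (qParam_tendsto_atImInfty one_pos)).congr fun τ =>
      SlashInvariantFormClass.eq_cuspFunction (E hk) τ one_mem_strictPeriods_SL one_ne_zero
  exact (Complex.continuous_re.tendsto 1).comp (h1.comp h0)

theorem continuousOn_re_E {k : ℕ} (hk : 3 ≤ k) :
    ContinuousOn (fun t : ℝ => (E hk (ofComplex (I * t))).re) (Set.Ioi 0) := by
  refine Complex.continuous_re.comp_continuousOn ?_
  have hE : Continuous (E hk) := (ModularFormClass.holo (E hk)).continuous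
  refine hE.comp_continuousOn fun t ht => ?_
  have hcont : ContinuousAt (fun z : ℂ => (ofComplex z : ℍ)) (I * t) :=
    (contMDiffAt_ofComplex (n := 1) (by simpa using ht)).continuousAt
  exact (ContinuousAt.comp (f := fun t : ℝ => I * (t : ℂ)) hcont
    (by fun_prop)).continuousWithinAt

/-- `E₆² / E₄³` takes every value in `[0, 1)` on the imaginary axis. -/
theorem exists_E₆_sq_eq {s : ℝ} (hs0 : 0 ≤ s) (hs1 : s < 1) :
    ∃ τ : ℍ, E₄ τ ≠ 0 ∧ E₆ τ ^ 2 = s * E₄ τ ^ 3 := by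
  set e₄ : ℝ → ℝ := fun t => (E₄ (ofComplex (I * t))).re
  set e₆ : ℝ → ℝ := fun t => (E₆ (ofComplex (I * t))).re
  -- The intermediate value theorem is applied to `E₆² - sE₄³`, which tends to `1 - s > 0` at `i∞`
  -- and is at most `0` at `i`, where `E₆` vanishes.
  have hlim : Tendsto (fun t => e₆ t ^ 2 - s * e₄ t ^ 3) atTop (𝓝 (1 ^ 2 - s * 1 ^ 3)) :=
    ((tendsto_re_E _ (by decide)).pow 2).sub (((tendsto_re_E _ (by decide)).pow 3).const_mul s)
  obtain ⟨T, hT, hT1⟩ := ((hlim.eventually_const_lt (u := 0) (by linarith)).and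
    (eventually_ge_atTop 1)).exists
  have hcont : ContinuousOn (fun t => e₆ t ^ 2 - s * e₄ t ^ 3) (Set.Icc 1 T) :=
    (((continuousOn_re_E _).pow 2).sub (((continuousOn_re_E _).pow 3).const_mul s)).mono
      fun t ht => Set.mem_Ioi.2 (one_pos.trans_le ht.1)
  have h1 : e₆ 1 ^ 2 - s * e₄ 1 ^ 3 ≤ 0 := by
    have h4 := one_le_re_E₄ one_pos
    have h6 : e₆ 1 = 0 := by simp only [e₆, E₆_I, Complex.zero_re]
    have : 0 ≤ s * e₄ 1 ^ 3 := mul_nonneg hs0 (pow_nonneg (zero_le_one.trans h4) 3)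
    rw [h6]
    linarith
  obtain ⟨t, ht, hzero⟩ := intermediate_value_Icc hT1 hcont ⟨h1, hT.le⟩
  have htpos : 0 < t := one_pos.trans_le ht.1
  refine ⟨ofComplex (I * t), fun h => ?_, ?_⟩
  · have h4 := one_le_re_E₄ htpos
    rw [h, Complex.zero_re] at h4
    linarith
  · have := congrArg ((↑) : ℝ → ℂ) (sub_eq_zero.1 hzero)
    simp only [e₄, e₆, Complex.ofReal_pow, Complex.ofReal_mul] at this
    rwa [ofReal_re_E _ (by decide) htpos, ofReal_re_E _ (by decide) htpos] at this

/-- A lattice with prescribed real invariants of positive discriminant. -/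
theorem exists_periodPair {a b : ℝ} (ha : 0 < a) (hab : 27 * b ^ 2 < a ^ 3) :
    ∃ L : PeriodPair, L.g₂ = a ∧ L.g₃ = b := by
  -- `E₆²/E₄³` equals the scale-invariant quotient `27g₃²/g₂³`.
  obtain ⟨τ, h4, h6⟩ := exists_E₆_sq_eq (s := 27 * b ^ 2 / a ^ 3) (by positivity)
    ((div_lt_one (by positivity)).2 hab)
  have ha' : (a : ℂ) ≠ 0 := by exact_mod_cast ha.ne'
  have hpi : (Real.pi : ℂ) ≠ 0 := by exact_mod_cast Real.pi_ne_zero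
  -- This `c` makes `g₂ = a`; then `g₃² = b²`, so only the sign of `g₃` is left open.
  obtain ⟨c, hc⟩ := IsAlgClosed.exists_pow_nat_eq (4 * (Real.pi : ℂ) ^ 4 / 3 * E₄ τ / a)
    (n := 4) (by norm_num)
  have hc0 : c ≠ 0 := by
    rintro rfl
    rw [zero_pow (by norm_num)] at hc
    exact div_ne_zero (mul_ne_zero (div_ne_zero (mul_ne_zero (by norm_num) (pow_ne_zero 4 hpi))
      (by norm_num)) h4) ha' hc.symm
  have g2 (c : ℂ) (hc : c ≠ 0) : (periodPairOfTau τ c hc).g₂ =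
      (c ^ 4)⁻¹ * (4 * (Real.pi : ℂ) ^ 4 / 3 * E₄ τ) := by
    have := riemannZeta_four
    rw [PeriodPair.g₂, G_periodPairOfTau τ c hc (by norm_num)]
    push_cast
    rw [this]
    ring
  have g3 (c : ℂ) (hc : c ≠ 0) : (periodPairOfTau τ c hc).g₃ =
      (c ^ 6)⁻¹ * (8 * (Real.pi : ℂ) ^ 6 / 27 * E₆ τ) := by
    have := riemannZeta_six
    rw [PeriodPair.g₃, G_periodPairOfTau τ c hc (by norm_num)]
    push_cast
    rw [this]
    ring
  have hg2 : (periodPairOfTau τ c hc0).g₂ = a := by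
    rw [g2, hc]
    field_simp
  have hg3 : (periodPairOfTau τ c hc0).g₃ ^ 2 = (b : ℂ) ^ 2 := by
    have e : ((c ^ 6)⁻¹ * (8 * (Real.pi : ℂ) ^ 6 / 27 * E₆ τ)) ^ 2 =
        ((c ^ 4) ^ 3)⁻¹ * (64 * (Real.pi : ℂ) ^ 12 / 729 * E₆ τ ^ 2) := by
      ring
    rw [g3, e, hc, h6]
    push_cast
    field_simp
    ring
  rcases sq_eq_sq_iff_eq_or_eq_neg.1 hg3 with h | h
  · exact ⟨_, hg2, h⟩
  -- Replacing `c` by `ic` keeps `c⁴` and negates `c⁶`.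
  · have hI : I * c ≠ 0 := mul_ne_zero I_ne_zero hc0
    refine ⟨periodPairOfTau τ (I * c) hI, ?_, ?_⟩
    · rw [g2] at hg2 ⊢
      rw [mul_pow, I_pow_four, one_mul, hg2]
    · rw [g3] at h ⊢
      have hI6 : I ^ 6 = -1 := by
        rw [show (6 : ℕ) = 2 * 3 by norm_num, pow_mul, I_sq]
        norm_num
      rw [mul_pow, hI6, neg_one_mul, inv_neg, neg_mul, h, neg_neg]

theorem exists_hasInvariants {κ : ℝ} (h0 : 0 < κ) (h1 : κ < 1) :
    ∃ L : PeriodPair, HasInvariants κ L := by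
  have hm : compl κ ^ 2 = 1 - κ ^ 2 := Real.sq_sqrt (by nlinarith)
  have hlt : 0 < 1 - κ ^ 2 := by nlinarith
  obtain ⟨L, h2, h3⟩ := exists_periodPair (a := compl κ ^ 2 + 1 / 3)
    (b := compl κ ^ 2 / 3 - 1 / 27) (by positivity) (by
      rw [hm]
      -- This is the discriminant `g₂³ - 27g₃² = λ²κ⁴`.
      have : 0 < (1 - κ ^ 2) * (κ ^ 2) ^ 2 := by positivity
      nlinarith)
  refine ⟨L, ?_, ?_⟩
  · rw [h2]; push_cast; ring
  · rw [h3]; push_cast; ring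

end Shen

theorem theoremp (κ : ℝ) (hκ0 : 0 < κ) (hκ1 : κ < 1) :
    (∃ L : PeriodPair, Shen.HasInvariants κ L) ∧
    ∀ L : PeriodPair, Shen.HasInvariants κ L →
      (∀ u : ℝ, (u : ℂ) ∉ L.lattice →
        (1 - (Shen.d κ u : ℂ)) * (1 / 3 + L.weierstrassP (u : ℂ)) = (κ : ℂ) ^ 2 / 2) ∧
      Shen.IsElliptic L (Shen.dn₂ κ L) ∧
      (∀ u : ℝ, AnalyticAt ℂ (Shen.dn₂ κ L) (u : ℂ)) ∧
      (∀ u : ℝ, Shen.dn₂ κ L (u : ℂ) = (Shen.d κ u : ℂ)) := by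
  exact ⟨Shen.exists_hasInvariants hκ0 hκ1, fun L hL =>
    ⟨fun u hu => Shen.one_sub_d_mul hκ0 hκ1 hL hu, Shen.isElliptic_dn₂,
      Shen.analyticAt_dn₂_ofReal hκ0 hκ1 hL, Shen.dn₂_ofReal hκ0 hκ1 hL⟩⟩
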